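/- \textbf{Lemma (Coercivity of the bilinear form).} Let $x_{\max}>0$, $\epsilon>0$, and let $\Omega=(-x_{\max},x_{\max})\times(-1,1)$ with points $(x,v)$ and boundary parts $$\Gamma^-=\{-x_{\max}\}\times[0,1)\,\cup\,\{x_{\max}\}\times(-1,0],\quad \Gamma^+=\{-x_{\max}\}\times(-1,0)\,\cup\,\{x_{\max}\}\times(0,1),\quad \Gamma_0=(-x_{\max},x_{\max})\times\{\pm1\},$$ and $\Gamma_0^-=\Gamma^-\cup\Gamma_0$. Let $M=\begin{bmatrix}M_{11}&M_{12}\\M_{12}&M_{22}\end{bmatrix}$ be a (constant) real symmetric nonnegative definite matrix with nonnegative entries, let $\sqrt M$ be its nonnegative definite square root, and let $N=\begin{bmatrix}M_{12}&M_{22}/2\\M_{22}/2&\epsilon\end{bmatrix}$. Write $(\cdot,\cdot)$ and $\|\cdot\|$ for the $L^2(\Omega)$ inner product and norm of scalar or vector fields, $\nabla w=(w_x,w_v)$ for the weak gradient, $\lambda_-(A)$ for the smallest eigenvalue of a symmetric matrix $A$, and, for $w,\phi\in H^1(\Omega)$, $$\mathcal H w=\begin{pmatrix}w\\ \sqrt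 M\,\nabla w\end{pmatrix},\qquad (w,\phi)_{\mathcal H}=(\mathcal Hw,\mathcal H\phi).$$ For $w,\phi\in H^2(\Omega)$ set $$a(w,\phi)=(v w_x,\phi)_{\mathcal H}+\epsilon\,(w_v,\phi_v)_{\mathcal H},$$ and let $H^2_{0,\Gamma_0^-}(\Omega)=\{w\in H^2(\Omega):\mathcal Hw=0\text{ on }\Gamma_0^-\}$, in the sense of traces. Let $\|\mathcal Hw\|_{\Gamma^+}^2=\int_{\Gamma^+}|\mathcal Hw|^2\,|v|\,ds$, where $\mathcal Hw$ is understood through its trace and $ds$ is arc length. If $4\epsilon M_{12}>M_{22}^2$, then $\lambda_-(N)>0$, and every $w\in H^2_{0,\Gamma_0^-}(\Omega)$ satisfies $$a(w,w)=\tfrac12\|\mathcal Hw\|_{\Gamma^+}^2+(\nabla w,N\nabla w)+\epsilon\,(\nabla w_v,M\nabla w_v)$$ and $$a(w,w)\ \ge\ \tfrac12\|\mathcal Hw\|_{\Gamma^+}^2+\lambda_-(N)\,\|\nabla w\|^2+\epsilon\,\lambda_-(M)\,\|\nabla w_v\|^2 .$$ -/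

import Mathlib

open MeasureTheory Filter Topology Set
open scoped ENNReal ContDiff Matrix MatrixOrder

noncomputable section

namespace Kolmogorov

/-- The position-velocity domain `(-X, X) × (-1, 1)`; points are written `z = (x, v)`. -/
def Dom (X : ℝ) : Set (ℝ × ℝ) := Ioo (-X) X ×ˢ Ioo (-1) 1

/-- The inflow boundary. -/
def inflow (X : ℝ) : Set (ℝ × ℝ) := ({-X} ×ˢ Ico 0 1) ∪ ({X} ×ˢ Ioc (-1) 0)

/-- The outflow boundary. -/
def outflow (X : ℝ) : Set (ℝ × ℝ) := ({-X} ×ˢ Ioo (-1) 0) ∪ ({X} ×ˢ Ioo 0 1)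

/-- The parabolic boundary. -/
def parabolic (X : ℝ) : Set (ℝ × ℝ) := Ioo (-X) X ×ˢ {-1, 1}

/-- Lebesgue measure on the domain. -/
def domMeas (X : ℝ) : Measure (ℝ × ℝ) := volume.restrict (Dom X)

/-- Surface (arc length) measure on the boundary of the rectangle, as the sum of the
one-dimensional Lebesgue measures of its four sides. -/
def bdryMeas (X : ℝ) : Measure (ℝ × ℝ) :=
  (volume.restrict (Ioo (-1 : ℝ) 1)).map (fun v => (-X, v))
    + (volume.restrict (Ioo (-1 : ℝ) 1)).map (fun v => (X, v))
    + (volume.restrict (Ioo (-X) X)).map (fun x => (x, (-1 : ℝ)))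
    + (volume.restrict (Ioo (-X) X)).map (fun x => (x, (1 : ℝ)))

/-- Classical partial derivative in `x`. -/
def dx (φ : ℝ × ℝ → ℝ) : ℝ × ℝ → ℝ := fun z => fderiv ℝ φ z (1, 0)

/-- Classical partial derivative in `v`. -/
def dv (φ : ℝ × ℝ → ℝ) : ℝ × ℝ → ℝ := fun z => fderiv ℝ φ z (0, 1)

/-- Classical derivative of multi-index `α = (α₁, α₂)`. -/
def classicalD (α : ℕ × ℕ) (φ : ℝ × ℝ → ℝ) : ℝ × ℝ → ℝ := dx^[α.1] (dv^[α.2] φ)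

/-- Test functions: smooth, with compact support contained in the open domain. -/
def IsTest (X : ℝ) (φ : ℝ × ℝ → ℝ) : Prop :=
  ContDiff ℝ ∞ φ ∧ HasCompactSupport φ ∧ tsupport φ ⊆ Dom X

/-- `g` is a square-integrable weak derivative of `w` of multi-index `α` in the domain. -/
def IsWeakD (X : ℝ) (α : ℕ × ℕ) (w g : ℝ × ℝ → ℝ) : Prop :=
  MemLp g 2 (domMeas X) ∧ ∀ φ : ℝ × ℝ → ℝ, IsTest X φ →
    ∫ z, w z * classicalD α φ z ∂(domMeas X)
      = (-1 : ℝ) ^ (α.1 + α.2) * ∫ z, g z * φ z ∂(domMeas X)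

/-- The Sobolev space `H^m` of the domain. -/
def MemH (X : ℝ) (m : ℕ) (w : ℝ × ℝ → ℝ) : Prop :=
  MemLp w 2 (domMeas X) ∧ ∀ α : ℕ × ℕ, α.1 + α.2 ≤ m → ∃ g, IsWeakD X α w g

open Classical in
/-- The square-integrable weak derivative of multi-index `α` (unique almost everywhere in the
domain; zero by convention if there is none). -/
def weakD (X : ℝ) (α : ℕ × ℕ) (w : ℝ × ℝ → ℝ) : ℝ × ℝ → ℝ :=
  if h : ∃ g, IsWeakD X α w g then h.choose else 0

/-- The weak derivatives `w_x` and `w_v`. -/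
def wx (X : ℝ) (w : ℝ × ℝ → ℝ) : ℝ × ℝ → ℝ := weakD X (1, 0) w

def wv (X : ℝ) (w : ℝ × ℝ → ℝ) : ℝ × ℝ → ℝ := weakD X (0, 1) w

/-- The weak gradient. -/
def grad (X : ℝ) (w : ℝ × ℝ → ℝ) : ℝ × ℝ → Fin 2 → ℝ := fun z => ![wx X w z, wv X w z]

/-- `g` is the trace on the boundary of `u ∈ H¹`: the `L²` limit of the boundary values of
functions, smooth up to the boundary, that converge to `u` in `H¹`. -/
def IsTrace (X : ℝ) (u g : ℝ × ℝ → ℝ) : Prop :=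
  MemH X 1 u ∧ MemLp g 2 (bdryMeas X) ∧
    ∃ φ : ℕ → ℝ × ℝ → ℝ, (∀ n, ContDiff ℝ ∞ (φ n)) ∧
      Tendsto (fun n => eLpNorm (fun z => φ n z - u z) 2 (domMeas X)) atTop (𝓝 0) ∧
      Tendsto (fun n => eLpNorm (fun z => dx (φ n) z - wx X u z) 2 (domMeas X)) atTop (𝓝 0) ∧
      Tendsto (fun n => eLpNorm (fun z => dv (φ n) z - wv X u z) 2 (domMeas X)) atTop (𝓝 0) ∧
      Tendsto (fun n => eLpNorm (fun z => φ n z - g z) 2 (bdryMeas X)) atTop (𝓝 0)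

open Classical in
/-- The trace of `u` (unique almost everywhere on the boundary). -/
def trace (X : ℝ) (u : ℝ × ℝ → ℝ) : ℝ × ℝ → ℝ :=
  if h : ∃ g, IsTrace X u g then h.choose else 0

/-- `u = 0` on the part `S` of the boundary, in the sense of traces. -/
def TraceZeroOn (X : ℝ) (S : Set (ℝ × ℝ)) (u : ℝ × ℝ → ℝ) : Prop :=
  ∃ g, IsTrace X u g ∧ ∀ᵐ z ∂((bdryMeas X).restrict S), g z = 0

/-- `𝓗 w = (w, √M ∇w)`, with `√M` the nonnegative definite square root. -/
def opH (X : ℝ) (M : Matrix (Fin 2) (Fin 2) ℝ) (w : ℝ × ℝ → ℝ) : ℝ × ℝ → Fin 3 → ℝ :=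
  fun z => Matrix.vecCons (w z) (CFC.sqrt M *ᵥ grad X w z)

/-- The `L²` inner product of vector-valued functions on the domain. -/
def innerL2 {k : ℕ} (X : ℝ) (F G : ℝ × ℝ → Fin k → ℝ) : ℝ :=
  ∫ z, F z ⬝ᵥ G z ∂(domMeas X)

/-- The bilinear form `⟨w, φ⟩_𝓗 = ⟨𝓗 w, 𝓗 φ⟩`. -/
def innerH (X : ℝ) (M : Matrix (Fin 2) (Fin 2) ℝ) (w φ : ℝ × ℝ → ℝ) : ℝ :=
  innerL2 X (opH X M w) (opH X M φ)

/-- The hypocoercive form `a(w, φ) = ⟨v w_x, φ⟩_𝓗 + ε ⟨w_v, φ_v⟩_𝓗`. -/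
def form (X ε : ℝ) (M : Matrix (Fin 2) (Fin 2) ℝ) (w φ : ℝ × ℝ → ℝ) : ℝ :=
  innerH X M (fun z => z.2 * wx X w z) φ + ε * innerH X M (wv X w) (wv X φ)

/-- The subspace of `w ∈ H²` with `𝓗 w = 0` on the inflow and parabolic boundary. -/
def H2Zero (X : ℝ) (M : Matrix (Fin 2) (Fin 2) ℝ) : Set (ℝ × ℝ → ℝ) :=
  {w | MemH X 2 w ∧
    ∀ i : Fin 3, TraceZeroOn X (inflow X ∪ parabolic X) (fun z => opH X M w z i)}

/-- `‖𝓗 w‖²` on the outflow boundary, with weight `|v|`. -/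
def outflowNormSq (X : ℝ) (M : Matrix (Fin 2) (Fin 2) ℝ) (w : ℝ × ℝ → ℝ) : ℝ :=
  ∫ z in outflow X, (∑ i : Fin 3, trace X (fun y => opH X M w y i) z ^ 2) * |z.2| ∂(bdryMeas X)

/-- The matrix `N`. -/
def matN (ε : ℝ) (M : Matrix (Fin 2) (Fin 2) ℝ) : Matrix (Fin 2) (Fin 2) ℝ :=
  !![M 0 1, M 1 1 / 2; M 1 1 / 2, ε]

/-- The smallest (real) eigenvalue. -/
def lamMin (A : Matrix (Fin 2) (Fin 2) ℝ) : ℝ :=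
  sInf {μ : ℝ | Module.End.HasEigenvalue (Matrix.toLin' A) μ}

end Kolmogorov

end

/-! With `ℋw = (w, √M ∇w)`, the transport part of `a(w, w)` splits by the product rule `∇(v w_x) = v
∂ₓ∇w + (0, w_x)`. The first piece is `(v ∂ₓℋw, ℋw)`; since `v` does not depend on `x`, integration
in `x` turns it into half the boundary integrals of `v |ℋw|²` over `x = ±X`. Zero inflow trace
leaves only the outflow part, where the outward flux is `|v|` (`integral_transport`). The commutator
piece contributes `M₁₂ w_x² + M₂₂ w_x w_v`. Together with `ε w_v²` from the diffusion this is the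
quadratic form of `N`, and the rest of the diffusion is `ε (∇w_v, M∇w_v)`.

As `det N = ε M₁₂ - M₂₂²/4 > 0` and `ε > 0`, `N` is positive definite; pointwise Rayleigh bounds
(`lamMin_mul_le`) then give the inequality.

The components of `ℋw` are only in `H¹`, so integration by parts is done on smooth approximants and
passed to the limit (`ApproxX.integral_weight`). Weak derivatives and traces are chosen
representatives, hence the uniqueness results `IsWeakD.ae_eq` and `IsTrace.side_ae_eq`. -/

namespace Kolmogorov

/-! ### Symmetric `2 × 2` matrices -/

/-- The smallest eigenvalue of a symmetric real `2 × 2` matrix, by the quadratic formula. -/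
theorem lamMin_eq (a b c : ℝ) :
    lamMin !![a, b; b, c] = (a + c - √((a - c) ^ 2 + 4 * b ^ 2)) / 2 := by
  have hs := Real.sq_sqrt (show 0 ≤ (a - c) ^ 2 + 4 * b ^ 2 by positivity)
  have hs0 := Real.sqrt_nonneg ((a - c) ^ 2 + 4 * b ^ 2)
  set s := √((a - c) ^ 2 + 4 * b ^ 2)
  have hchar : ∀ μ : ℝ, Module.End.HasEigenvalue (Matrix.toLin' !![a, b; b, c]) μ ↔
      (μ - (a + c - s) / 2) * (μ - (a + c + s) / 2) = 0 := by
    intro μ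
    rw [Module.End.hasEigenvalue_iff_mem_spectrum, Matrix.spectrum_toLin',
      Matrix.mem_spectrum_iff_isRoot_charpoly, Matrix.charpoly_fin_two]
    simp only [Matrix.trace_fin_two_of, Matrix.det_fin_two_of, Polynomial.IsRoot.def,
      Polynomial.eval_add, Polynomial.eval_sub, Polynomial.eval_pow, Polynomial.eval_X,
      Polynomial.eval_mul, Polynomial.eval_C]
    constructor <;> intro h <;> linarith
  refine IsLeast.csInf_eq ⟨(hchar _).2 (by simp), fun μ hμ => ?_⟩
  rcases mul_eq_zero.1 ((hchar μ).1 hμ) with h | h <;> linarith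

theorem lamMin_pos {a b c : ℝ} (hc : 0 < c) (hdet : b ^ 2 < a * c) :
    0 < lamMin !![a, b; b, c] := by
  have ha : 0 < a := pos_of_mul_pos_left (lt_of_le_of_lt (sq_nonneg b) hdet) hc.le
  have : √((a - c) ^ 2 + 4 * b ^ 2) < a + c := by
    rw [Real.sqrt_lt' (by positivity)]
    nlinarith
  rw [lamMin_eq]
  linarith

/-- The Rayleigh quotient is bounded below by the smallest eigenvalue. -/
theorem lamMin_mul_le {A : Matrix (Fin 2) (Fin 2) ℝ} (hA : A 1 0 = A 0 1) (x : Fin 2 → ℝ) :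
    lamMin A * (x ⬝ᵥ x) ≤ x ⬝ᵥ A *ᵥ x := by
  have hA' : A = !![A 0 0, A 0 1; A 0 1, A 1 1] := by
    ext i j; fin_cases i <;> fin_cases j <;> simp [hA]
  generalize A 0 0 = a, A 0 1 = b, A 1 1 = c at hA'
  subst hA'
  rw [lamMin_eq]
  have hs := Real.sq_sqrt (show 0 ≤ (a - c) ^ 2 + 4 * b ^ 2 by positivity)
  have hs1 : |a - c| ≤ √((a - c) ^ 2 + 4 * b ^ 2) :=
    Real.abs_le_sqrt (by nlinarith [sq_nonneg b])
  set s := √((a - c) ^ 2 + 4 * b ^ 2)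
  simp only [Matrix.mulVec, dotProduct, Fin.sum_univ_two, Matrix.of_apply, Matrix.cons_val_zero,
    Matrix.cons_val_one]
  obtain ⟨h1, h2⟩ := abs_le.1 hs1
  generalize x 0 = p, x 1 = q
  -- These are the diagonal entries of `A - λI` at the smallest eigenvalue `λ`. That matrix is
  -- singular, so their product is `b²` and its form is, up to a nonnegative factor, a perfect
  -- square.
  have hα : 0 ≤ (a - c + s) / 2 := by linarith
  have hγ : 0 ≤ (c - a + s) / 2 := by linarith
  have hb : ((a - c + s) / 2) * ((c - a + s) / 2) = b ^ 2 := by linarith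
  suffices 0 ≤ (a - c + s) / 2 * p ^ 2 + 2 * b * p * q + (c - a + s) / 2 * q ^ 2 by linarith
  generalize (a - c + s) / 2 = α, (c - a + s) / 2 = γ at *
  rcases hα.eq_or_lt with h0 | h0
  · have : b = 0 := by rw [← h0, zero_mul] at hb; exact pow_eq_zero_iff (two_ne_zero) |>.1 hb.symm
    rw [← h0, this]; simp only [zero_mul, mul_zero, zero_add]; positivity
  · refine nonneg_of_mul_nonneg_right (a := α) ?_ h0
    have : α * (α * p ^ 2 + 2 * b * p * q + γ * q ^ 2) = (α * p + b * q) ^ 2 := by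
      linear_combination q ^ 2 * hb
    rw [this]; positivity

/-- `√M` is symmetric and squares to `M`, so its entries never have to be computed. -/
theorem sqrt_mulVec_dotProduct {M : Matrix (Fin 2) (Fin 2) ℝ} (hM : M.PosSemidef)
    (x y : Fin 2 → ℝ) :
    (CFC.sqrt M *ᵥ x) ⬝ᵥ (CFC.sqrt M *ᵥ y) = x ⬝ᵥ M *ᵥ y := by
  have h0 : 0 ≤ M := hM.nonneg
  have hsq := CFC.sqrt_mul_sqrt_self M h0
  have hs : (CFC.sqrt M)ᵀ = CFC.sqrt M := by
    have := (Matrix.nonneg_iff_posSemidef.1 (CFC.sqrt_nonneg M)).isHermitian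
    simpa [Matrix.IsHermitian, Matrix.conjTranspose_eq_transpose_of_trivial] using this
  conv_rhs => rw [← hsq, ← Matrix.mulVec_mulVec, Matrix.dotProduct_mulVec,
    ← Matrix.mulVec_transpose, hs]

/-! ### Weak derivatives -/

theorem isOpen_dom (X : ℝ) : IsOpen (Dom X) := isOpen_Ioo.prod isOpen_Ioo

instance (X : ℝ) : IsFiniteMeasure (domMeas X) := by
  constructor
  rw [domMeas, Measure.restrict_apply_univ, Dom, Measure.volume_eq_prod, Measure.prod_prod]
  simp [ENNReal.mul_lt_top]

theorem _root_.Continuous.memLp_dom {φ : ℝ × ℝ → ℝ} (hφ : Continuous φ) (X : ℝ) (p : ℝ≥0∞) :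
    MemLp φ p (domMeas X) := by
  have hK : IsCompact (Icc (-X) X ×ˢ Icc (-1 : ℝ) 1) := isCompact_Icc.prod isCompact_Icc
  obtain ⟨C, hC⟩ := hK.exists_bound_of_continuousOn hφ.continuousOn
  refine MemLp.of_bound hφ.aestronglyMeasurable C ?_
  filter_upwards [ae_restrict_mem (isOpen_dom X).measurableSet] with z hz
  exact hC z ⟨Ioo_subset_Icc_self hz.1, Ioo_subset_Icc_self hz.2⟩

theorem integrable_mul {μ : Measure (ℝ × ℝ)} {f g : ℝ × ℝ → ℝ} (hf : MemLp f 2 μ)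
    (hg : MemLp g 2 μ) : Integrable (fun z => f z * g z) μ :=
  hf.integrable_mul hg

theorem contDiff_dx {φ : ℝ × ℝ → ℝ} (hφ : ContDiff ℝ ∞ φ) : ContDiff ℝ ∞ (dx φ) :=
  (hφ.fderiv_right (m := ∞) (by simp)).clm_apply contDiff_const

theorem contDiff_dv {φ : ℝ × ℝ → ℝ} (hφ : ContDiff ℝ ∞ φ) : ContDiff ℝ ∞ (dv φ) :=
  (hφ.fderiv_right (m := ∞) (by simp)).clm_apply contDiff_const

theorem tsupport_dir_subset (φ : ℝ × ℝ → ℝ) (e : ℝ × ℝ) :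
    tsupport (fun z => fderiv ℝ φ z e) ⊆ tsupport φ := by
  refine (closure_mono ?_).trans (tsupport_fderiv_subset ℝ (f := φ))
  intro z hz h
  exact hz (by simp only [h, zero_apply])

theorem IsTest.of_tsupport_subset {X : ℝ} {φ ψ : ℝ × ℝ → ℝ} (hφ : IsTest X φ)
    (hψ : ContDiff ℝ ∞ ψ) (h : tsupport ψ ⊆ tsupport φ) : IsTest X ψ :=
  ⟨hψ, hφ.2.1.of_isClosed_subset (isClosed_tsupport ψ) h, h.trans hφ.2.2⟩

theorem IsTest.dx {X : ℝ} {φ : ℝ × ℝ → ℝ} (hφ : IsTest X φ) : IsTest X (dx φ) :=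
  hφ.of_tsupport_subset (contDiff_dx hφ.1) (tsupport_dir_subset φ _)

theorem IsTest.dv {X : ℝ} {φ : ℝ × ℝ → ℝ} (hφ : IsTest X φ) : IsTest X (dv φ) :=
  hφ.of_tsupport_subset (contDiff_dv hφ.1) (tsupport_dir_subset φ _)

theorem IsTest.snd_mul {X : ℝ} {φ : ℝ × ℝ → ℝ} (hφ : IsTest X φ) :
    IsTest X (fun z => z.2 * φ z) :=
  hφ.of_tsupport_subset (contDiff_snd.mul hφ.1) tsupport_mul_subset_right

theorem IsTest.memLp {X : ℝ} {φ : ℝ × ℝ → ℝ} (hφ : IsTest X φ) : MemLp φ 2 (domMeas X) :=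
  hφ.1.continuous.memLp_dom X 2

theorem dx_snd_mul {φ : ℝ × ℝ → ℝ} (hφ : ContDiff ℝ ∞ φ) (z : ℝ × ℝ) :
    dx (fun z => z.2 * φ z) z = z.2 * dx φ z := by
  have h1 : HasFDerivAt φ (fderiv ℝ φ z) z := (hφ.differentiable (by simp) z).hasFDerivAt
  have h := (hasFDerivAt_snd (𝕜 := ℝ) (p := z)).mul h1
  simp only [dx]
  rw [show fderiv ℝ (fun z : ℝ × ℝ => z.2 * φ z) z = _ from h.fderiv]
  simp

theorem dv_snd_mul {φ : ℝ × ℝ → ℝ} (hφ : ContDiff ℝ ∞ φ) (z : ℝ × ℝ) :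
    dv (fun z => z.2 * φ z) z = z.2 * dv φ z + φ z := by
  have h1 : HasFDerivAt φ (fderiv ℝ φ z) z := (hφ.differentiable (by simp) z).hasFDerivAt
  have h := (hasFDerivAt_snd (𝕜 := ℝ) (p := z)).mul h1
  simp only [dv]
  rw [show fderiv ℝ (fun z : ℝ × ℝ => z.2 * φ z) z = _ from h.fderiv]
  simp

theorem dv_dx {φ : ℝ × ℝ → ℝ} (hφ : ContDiff ℝ ∞ φ) : dv (dx φ) = dx (dv φ) := by
  funext z
  have hd : DifferentiableAt ℝ (fderiv ℝ φ) z :=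
    (hφ.fderiv_right (m := ∞) (by simp)).differentiable (by simp) z
  have hsymm : IsSymmSndFDerivAt ℝ φ z :=
    (contDiff_infty.1 hφ 2).contDiffAt.isSymmSndFDerivAt (by simp)
  have key : ∀ a b : ℝ × ℝ, fderiv ℝ (fun y => fderiv ℝ φ y a) z b = fderiv ℝ (fderiv ℝ φ) z b a := by
    intro a b
    have := (hd.hasFDerivAt.clm_apply (hasFDerivAt_const a z)).fderiv
    rw [this]; simp
  exact (key (1, 0) (0, 1)).trans ((hsymm _ _).trans (key (0, 1) (1, 0)).symm)

/-- This is the fundamental lemma of the calculus of variations applied to `g - g'`. It lets the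
chosen `weakD` be replaced by any explicit weak derivative. -/
theorem IsWeakD.ae_eq {X : ℝ} {α : ℕ × ℕ} {w w' g g' : ℝ × ℝ → ℝ} (hw : w =ᵐ[domMeas X] w')
    (hg : IsWeakD X α w g) (hg' : IsWeakD X α w' g') : g =ᵐ[domMeas X] g' := by
  have hsub : MemLp (fun z => g z - g' z) 2 (domMeas X) := hg.1.sub hg'.1
  have hint : IntegrableOn (fun z => g z - g' z) (Dom X) volume :=
    hsub.integrable (by norm_num)
  have := (isOpen_dom X).ae_eq_zero_of_integral_contDiff_smul_eq_zero
    (hint.locallyIntegrableOn) (fun φ h1 h2 h3 => ?_)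
  · refine (ae_restrict_iff' (isOpen_dom X).measurableSet).2 ?_
    filter_upwards [this] with z hz hzD
    exact sub_eq_zero.1 (hz hzD)
  · have hφ : IsTest X φ := ⟨h1, h2, h3⟩
    have e1 := hg.2 φ hφ
    have e2 := hg'.2 φ hφ
    have e3 : ∫ z, w z * classicalD α φ z ∂domMeas X = ∫ z, w' z * classicalD α φ z ∂domMeas X :=
      integral_congr_ae (hw.mono fun z hz => by simp only [hz])
    rw [e1, e2] at e3
    have e4 := mul_left_cancel₀ (pow_ne_zero _ (by norm_num)) e3
    have e5 : ∫ z, φ z • (g z - g' z) ∂domMeas X = 0 := by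
      have : ∀ z, φ z • (g z - g' z) = g z * φ z - g' z * φ z := fun z => by
        simp only [smul_eq_mul]; ring
      simp only [this]
      rw [integral_sub (integrable_mul hg.1 hφ.memLp) (integrable_mul hg'.1 hφ.memLp), e4, sub_self]
    -- The fundamental lemma integrates over the whole plane; `φ` vanishes off the domain.
    rw [← e5, domMeas, setIntegral_eq_integral_of_forall_compl_eq_zero]
    intro z hz
    rw [image_eq_zero_of_notMem_tsupport (fun h => hz (h3 h)), zero_smul]

theorem isWeakD_weakD {X : ℝ} {α : ℕ × ℕ} {w : ℝ × ℝ → ℝ} (h : ∃ g, IsWeakD X α w g) :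
    IsWeakD X α w (weakD X α w) := by
  rw [weakD, dif_pos h]; exact h.choose_spec

theorem IsWeakD.weakD_ae_eq {X : ℝ} {α : ℕ × ℕ} {w g : ℝ × ℝ → ℝ} (h : IsWeakD X α w g) :
    weakD X α w =ᵐ[domMeas X] g :=
  IsWeakD.ae_eq (EventuallyEq.refl _ _) (isWeakD_weakD ⟨g, h⟩) h

theorem isWeakD_x_iff {X : ℝ} {w g : ℝ × ℝ → ℝ} : IsWeakD X (1, 0) w g ↔
    MemLp g 2 (domMeas X) ∧ ∀ φ : ℝ × ℝ → ℝ, IsTest X φ →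
      ∫ z, w z * dx φ z ∂(domMeas X) = -∫ z, g z * φ z ∂(domMeas X) := by
  simp [IsWeakD, classicalD]

theorem isWeakD_v_iff {X : ℝ} {w g : ℝ × ℝ → ℝ} : IsWeakD X (0, 1) w g ↔
    MemLp g 2 (domMeas X) ∧ ∀ φ : ℝ × ℝ → ℝ, IsTest X φ →
      ∫ z, w z * dv φ z ∂(domMeas X) = -∫ z, g z * φ z ∂(domMeas X) := by
  simp [IsWeakD, classicalD]

/-- A partial derivative of a test function is again a test function, so the definition of the first
derivative may be tested with it. The next three lemmas rest on the same remark. -/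
theorem IsWeakD.x_x {X : ℝ} {w g h : ℝ × ℝ → ℝ} (hg : IsWeakD X (1, 0) w g)
    (hh : IsWeakD X (2, 0) w h) : IsWeakD X (1, 0) g h := by
  refine isWeakD_x_iff.2 ⟨hh.1, fun φ hφ => ?_⟩
  have e1 := (isWeakD_x_iff.1 hg).2 _ hφ.dx
  have e2 := hh.2 φ hφ
  simp only [classicalD, Function.iterate_succ, Function.iterate_zero, Function.comp_apply,
    id] at e2
  norm_num at e2
  linarith

theorem IsWeakD.v_x {X : ℝ} {w g h : ℝ × ℝ → ℝ} (hg : IsWeakD X (1, 0) w g)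
    (hh : IsWeakD X (1, 1) w h) : IsWeakD X (0, 1) g h := by
  refine isWeakD_v_iff.2 ⟨hh.1, fun φ hφ => ?_⟩
  have e1 := (isWeakD_x_iff.1 hg).2 _ hφ.dv
  have e2 := hh.2 φ hφ
  simp only [classicalD, Function.iterate_succ, Function.iterate_zero, Function.comp_apply,
    id] at e2
  norm_num at e2
  linarith

theorem IsWeakD.x_v {X : ℝ} {w g h : ℝ × ℝ → ℝ} (hg : IsWeakD X (0, 1) w g)
    (hh : IsWeakD X (1, 1) w h) : IsWeakD X (1, 0) g h := by
  refine isWeakD_x_iff.2 ⟨hh.1, fun φ hφ => ?_⟩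
  have e1 := (isWeakD_v_iff.1 hg).2 _ hφ.dx
  -- `classicalD (1, 1)` differentiates in `v` first, so the mixed partials must be swapped.
  rw [dv_dx hφ.1] at e1
  have e2 := hh.2 φ hφ
  simp only [classicalD, Function.iterate_succ, Function.iterate_zero, Function.comp_apply,
    id] at e2
  norm_num at e2
  linarith

theorem IsWeakD.v_v {X : ℝ} {w g h : ℝ × ℝ → ℝ} (hg : IsWeakD X (0, 1) w g)
    (hh : IsWeakD X (0, 2) w h) : IsWeakD X (0, 1) g h := by
  refine isWeakD_v_iff.2 ⟨hh.1, fun φ hφ => ?_⟩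
  have e1 := (isWeakD_v_iff.1 hg).2 _ hφ.dv
  have e2 := hh.2 φ hφ
  simp only [classicalD, Function.iterate_succ, Function.iterate_zero, Function.comp_apply,
    id] at e2
  norm_num at e2
  linarith

theorem MemLp.const_mul_add {X : ℝ} {f g : ℝ × ℝ → ℝ} (hf : MemLp f 2 (domMeas X))
    (hg : MemLp g 2 (domMeas X)) (a b : ℝ) :
    MemLp (fun z => a * f z + b * g z) 2 (domMeas X) :=
  (hf.const_mul a).add (hg.const_mul b)

theorem MemLp.snd_mul {X : ℝ} {f : ℝ × ℝ → ℝ} (hf : MemLp f 2 (domMeas X)) :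
    MemLp (fun z => z.2 * f z) 2 (domMeas X) := by
  refine hf.mono (continuous_snd.aestronglyMeasurable.mul hf.1) ?_
  filter_upwards [ae_restrict_mem (isOpen_dom X).measurableSet] with z hz
  rw [norm_mul]
  exact mul_le_of_le_one_left (norm_nonneg _) (abs_le.2 ⟨hz.2.1.le, hz.2.2.le⟩)

theorem IsWeakD.lincomb {X : ℝ} {w w' g g' : ℝ × ℝ → ℝ} (hw : MemLp w 2 (domMeas X))
    (hw' : MemLp w' 2 (domMeas X)) (hg : IsWeakD X (1, 0) w g) (hg' : IsWeakD X (1, 0) w' g')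
    (a b : ℝ) :
    IsWeakD X (1, 0) (fun z => a * w z + b * w' z) (fun z => a * g z + b * g' z) := by
  refine isWeakD_x_iff.2 ⟨MemLp.const_mul_add hg.1 hg'.1 a b, fun φ hφ => ?_⟩
  have e := (isWeakD_x_iff.1 hg).2 φ hφ
  have e' := (isWeakD_x_iff.1 hg').2 φ hφ
  have lin : ∀ {f f' ψ : ℝ × ℝ → ℝ}, MemLp f 2 (domMeas X) → MemLp f' 2 (domMeas X) →
      MemLp ψ 2 (domMeas X) → ∫ z, (a * f z + b * f' z) * ψ z ∂domMeas X
        = a * ∫ z, f z * ψ z ∂domMeas X + b * ∫ z, f' z * ψ z ∂domMeas X := by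
    intro f f' ψ hf hf' hψ
    simp only [add_mul, mul_assoc]
    rw [integral_add ((integrable_mul hf hψ).const_mul a) ((integrable_mul hf' hψ).const_mul b),
      integral_const_mul, integral_const_mul]
  rw [lin hw hw' hφ.dx.memLp, lin hg.1 hg'.1 hφ.memLp, e, e']
  ring

theorem IsWeakD.snd_mul_x {X : ℝ} {w g : ℝ × ℝ → ℝ} (hg : IsWeakD X (1, 0) w g) :
    IsWeakD X (1, 0) (fun z => z.2 * w z) (fun z => z.2 * g z) := by
  refine isWeakD_x_iff.2 ⟨MemLp.snd_mul hg.1, fun φ hφ => ?_⟩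
  have e := (isWeakD_x_iff.1 hg).2 _ hφ.snd_mul
  simp only [dx_snd_mul hφ.1] at e
  convert e using 3
  · ring
  · funext z; ring

/-- The product rule falls on the test function `v φ`. The extra term `w` is the commutator of `∂ᵥ`
with multiplication by `v`, the source of control on `w_x`. -/
theorem IsWeakD.snd_mul_v {X : ℝ} {w g : ℝ × ℝ → ℝ} (hw : MemLp w 2 (domMeas X))
    (hg : IsWeakD X (0, 1) w g) :
    IsWeakD X (0, 1) (fun z => z.2 * w z) (fun z => z.2 * g z + w z) := by
  refine isWeakD_v_iff.2 ⟨(MemLp.snd_mul hg.1).add hw, fun φ hφ => ?_⟩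
  have e := (isWeakD_v_iff.1 hg).2 _ hφ.snd_mul
  simp only [dv_snd_mul hφ.1, mul_add] at e
  rw [integral_add (integrable_mul hw (MemLp.snd_mul hφ.dv.memLp))
    (integrable_mul hw hφ.memLp)] at e
  simp only [add_mul]
  rw [integral_add (integrable_mul (MemLp.snd_mul hg.1) hφ.memLp) (integrable_mul hw hφ.memLp)]
  have e1 : ∫ z, z.2 * w z * dv φ z ∂domMeas X = ∫ z, w z * (z.2 * dv φ z) ∂domMeas X := by
    congr 1; ext z; ring
  have e2 : ∫ z, z.2 * g z * φ z ∂domMeas X = ∫ z, g z * (z.2 * φ z) ∂domMeas X := by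
    congr 1; ext z; ring
  rw [e1, e2]
  linarith

/-! ### Traces on the sides `x = ±X` -/

/-- Continuity of the inner product of `L²`. -/
theorem tendsto_integral_mul {α : Type*} [MeasurableSpace α] {μ : Measure α}
    {f g : ℕ → α → ℝ} {f₀ g₀ : α → ℝ} (hf : ∀ n, MemLp (f n) 2 μ) (hg : ∀ n, MemLp (g n) 2 μ)
    (hf₀ : MemLp f₀ 2 μ) (hg₀ : MemLp g₀ 2 μ)
    (hfl : Tendsto (fun n => eLpNorm (fun z => f n z - f₀ z) 2 μ) atTop (𝓝 0))
    (hgl : Tendsto (fun n => eLpNorm (fun z => g n z - g₀ z) 2 μ) atTop (𝓝 0)) :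
    Tendsto (fun n => ∫ z, f n z * g n z ∂μ) atTop (𝓝 (∫ z, f₀ z * g₀ z ∂μ)) := by
  have key : ∀ {a b : α → ℝ} (ha : MemLp a 2 μ) (hb : MemLp b 2 μ),
      inner ℝ (hb.toLp b) (ha.toLp a) = ∫ z, a z * b z ∂μ := by
    intro a b ha hb
    rw [L2.inner_def]
    refine integral_congr_ae ?_
    filter_upwards [ha.coeFn_toLp, hb.coeFn_toLp] with z h1 h2
    rw [h1, h2]; rfl
  have h1 := (Lp.tendsto_Lp_iff_tendsto_eLpNorm'' f hf f₀ hf₀).2 hfl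
  have h2 := (Lp.tendsto_Lp_iff_tendsto_eLpNorm'' g hg g₀ hg₀).2 hgl
  have h3 := h2.inner (𝕜 := ℝ) h1
  simpa only [key] using h3

theorem tendsto_integral_weight_mul {α : Type*} [MeasurableSpace α] {μ : Measure α} {p : α → ℝ}
    {C : ℝ} (hp : AEStronglyMeasurable p μ) (hC : ∀ᵐ z ∂μ, ‖p z‖ ≤ C)
    {f g : ℕ → α → ℝ} {f₀ g₀ : α → ℝ} (hf : ∀ n, MemLp (f n) 2 μ) (hg : ∀ n, MemLp (g n) 2 μ)
    (hf₀ : MemLp f₀ 2 μ) (hg₀ : MemLp g₀ 2 μ)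
    (hfl : Tendsto (fun n => eLpNorm (fun z => f n z - f₀ z) 2 μ) atTop (𝓝 0))
    (hgl : Tendsto (fun n => eLpNorm (fun z => g n z - g₀ z) 2 μ) atTop (𝓝 0)) :
    Tendsto (fun n => ∫ z, p z * (f n z * g n z) ∂μ) atTop
      (𝓝 (∫ z, p z * (f₀ z * g₀ z) ∂μ)) := by
  have hmul : ∀ {a : α → ℝ}, MemLp a 2 μ → MemLp (fun z => p z * a z) 2 μ := fun ha =>
    ha.of_le_mul (c := C) (hp.mul ha.1) (hC.mono fun z hz => by
      rw [norm_mul]; exact mul_le_mul_of_nonneg_right hz (norm_nonneg _))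
  have hlim : Tendsto (fun n => eLpNorm (fun z => p z * f n z - p z * f₀ z) 2 μ) atTop (𝓝 0) := by
    have h0 : Tendsto (fun n => ENNReal.ofReal C * eLpNorm (fun z => f n z - f₀ z) 2 μ) atTop
        (𝓝 0) := by
      simpa using ENNReal.Tendsto.const_mul hfl (Or.inr ENNReal.ofReal_ne_top)
    refine tendsto_of_tendsto_of_tendsto_of_le_of_le tendsto_const_nhds h0 (fun _ => zero_le)
      (fun n => eLpNorm_le_mul_eLpNorm_of_ae_le_mul (hC.mono fun z hz => ?_) 2)
    rw [← mul_sub, norm_mul]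
    exact mul_le_mul_of_nonneg_right hz (norm_nonneg _)
  simpa only [mul_assoc] using
    tendsto_integral_mul (fun n => hmul (hf n)) hg (hmul hf₀) hg₀ hlim hgl

/-- The one-dimensional measure along the sides `x = ±X`. -/
noncomputable abbrev sideMeas : Measure ℝ := volume.restrict (Ioo (-1) 1)

/-- Each vertical side is one summand of the boundary measure, so integrability and `L²` convergence
on the boundary pass to it. -/
theorem map_side_le_bdryMeas {X x : ℝ} (hx : x = X ∨ x = -X) :
    sideMeas.map (fun v => (x, v)) ≤ bdryMeas X := by
  intro s
  simp only [bdryMeas, Measure.add_apply, add_assoc]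
  rcases hx with rfl | rfl
  · exact le_self_add.trans le_add_self
  · exact le_self_add

theorem memLp_side {X x : ℝ} (hx : x = X ∨ x = -X) {g : ℝ × ℝ → ℝ}
    (hg : MemLp g 2 (bdryMeas X)) : MemLp (fun v => g (x, v)) 2 sideMeas :=
  (measurableEmbedding_prodMk_left x).memLp_map_measure_iff.1
    (hg.mono_measure (map_side_le_bdryMeas hx))

theorem eLpNorm_side_le {X x : ℝ} (hx : x = X ∨ x = -X) (g : ℝ × ℝ → ℝ) :
    eLpNorm (fun v => g (x, v)) 2 sideMeas ≤ eLpNorm g 2 (bdryMeas X) := by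
  have := (measurableEmbedding_prodMk_left (β := ℝ) x).eLpNorm_map_measure (p := 2)
    (μ := sideMeas) (g := g)
  rw [Function.comp_def] at this
  rw [← this]
  exact eLpNorm_mono_measure _ (map_side_le_bdryMeas hx)

theorem memLp_side_of_continuous {φ : ℝ → ℝ} (hφ : Continuous φ) : MemLp φ 2 sideMeas := by
  obtain ⟨C, hC⟩ := isCompact_Icc.exists_bound_of_continuousOn (s := Icc (-1 : ℝ) 1) hφ.continuousOn
  refine MemLp.of_bound hφ.aestronglyMeasurable C ?_
  filter_upwards [ae_restrict_mem measurableSet_Ioo] with z hz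
  exact hC z (Ioo_subset_Icc_self hz)

/-- Fubini, then the fundamental theorem of calculus on each horizontal line. -/
theorem integral_dx {X : ℝ} (hX : 0 < X) {F : ℝ × ℝ → ℝ} (hF : ContDiff ℝ ∞ F) :
    ∫ z, dx F z ∂domMeas X = ∫ v, (F (X, v) - F (-X, v)) ∂sideMeas := by
  have hint : Integrable (dx F) (domMeas X) :=
    ((contDiff_dx hF).continuous.memLp_dom X 1).integrable le_rfl
  have hm : domMeas X = (volume.restrict (Ioo (-X) X)).prod sideMeas := by
    rw [domMeas, Dom, Measure.volume_eq_prod, Measure.prod_restrict]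
  rw [hm] at hint ⊢
  rw [integral_prod_symm _ hint]
  refine integral_congr_ae (ae_of_all _ fun v => ?_)
  have hd : ∀ x, HasDerivAt (fun x => F (x, v)) (dx F (x, v)) x := by
    intro x
    have h1 : HasFDerivAt F (fderiv ℝ F (x, v)) (x, v) :=
      (hF.differentiable (by simp) _).hasFDerivAt
    exact h1.comp_hasDerivAt x ((hasDerivAt_id x).prodMk (hasDerivAt_const x v))
  have hc : Continuous (fun x => dx F (x, v)) := (contDiff_dx hF).continuous.comp (by fun_prop)
  have := intervalIntegral.integral_eq_sub_of_hasDerivAt (a := -X) (b := X) (fun x _ => hd x)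
    (hc.intervalIntegrable _ _)
  beta_reduce
  rw [← this, intervalIntegral.integral_of_le (by linarith), integral_Ioc_eq_integral_Ioo]

/-- The functions `u`, `u'`, `g` are the limits, in the interior and on the boundary, of smooth
functions, of their `x`-derivatives, and of their boundary values. -/
structure ApproxX (X : ℝ) (φ : ℕ → ℝ × ℝ → ℝ) (u u' g : ℝ × ℝ → ℝ) : Prop where
  smooth : ∀ n, ContDiff ℝ ∞ (φ n)
  memLp : MemLp u 2 (domMeas X)
  memLp_dx : MemLp u' 2 (domMeas X)
  memLp_bdry : MemLp g 2 (bdryMeas X)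
  tendsto : Tendsto (fun n => eLpNorm (fun z => φ n z - u z) 2 (domMeas X)) atTop (𝓝 0)
  tendsto_dx : Tendsto (fun n => eLpNorm (fun z => dx (φ n) z - u' z) 2 (domMeas X)) atTop (𝓝 0)
  tendsto_bdry : Tendsto (fun n => eLpNorm (fun z => φ n z - g z) 2 (bdryMeas X)) atTop (𝓝 0)

theorem dx_mul_sq {p φ : ℝ × ℝ → ℝ} (hp : ContDiff ℝ ∞ p) (hφ : ContDiff ℝ ∞ φ) (z : ℝ × ℝ) :
    dx (fun z => p z * (φ z * φ z)) z = 2 * (p z * (φ z * dx φ z)) + dx p z * (φ z * φ z) := by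
  have h1 : HasFDerivAt φ (fderiv ℝ φ z) z := (hφ.differentiable (by simp) z).hasFDerivAt
  have h2 : HasFDerivAt p (fderiv ℝ p z) z := (hp.differentiable (by simp) z).hasFDerivAt
  have h := h2.mul (h1.mul h1)
  simp only [dx]
  rw [show fderiv ℝ (fun z => p z * (φ z * φ z)) z = _ from h.fderiv]
  simp
  ring

/-- Weighted integration by parts in `x` for a function with a trace. -/
theorem ApproxX.integral_weight {X : ℝ} (hX : 0 < X) {φ : ℕ → ℝ × ℝ → ℝ} {u u' g p : ℝ × ℝ → ℝ}
    (h : ApproxX X φ u u' g) (hp : ContDiff ℝ ∞ p) :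
    2 * ∫ z, p z * (u z * u' z) ∂domMeas X + ∫ z, dx p z * (u z * u z) ∂domMeas X
      = ∫ v, p (X, v) * (g (X, v) * g (X, v)) ∂sideMeas
        - ∫ v, p (-X, v) * (g (-X, v) * g (-X, v)) ∂sideMeas := by
  have hbd : ∀ {q : ℝ × ℝ → ℝ}, Continuous q → ∃ C, ∀ᵐ z ∂domMeas X, ‖q z‖ ≤ C := by
    intro q hq
    obtain ⟨C, hC⟩ := (isCompact_Icc.prod isCompact_Icc).exists_bound_of_continuousOn
      (s := Icc (-X) X ×ˢ Icc (-1 : ℝ) 1) hq.continuousOn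
    refine ⟨C, ?_⟩
    filter_upwards [ae_restrict_mem (isOpen_dom X).measurableSet] with z hz
    exact hC z ⟨Ioo_subset_Icc_self hz.1, Ioo_subset_Icc_self hz.2⟩
  have hφ : ∀ n, MemLp (φ n) 2 (domMeas X) := fun n => (h.smooth n).continuous.memLp_dom X 2
  have hφ' : ∀ n, MemLp (dx (φ n)) 2 (domMeas X) :=
    fun n => (contDiff_dx (h.smooth n)).continuous.memLp_dom X 2
  obtain ⟨C₁, hC₁⟩ := hbd hp.continuous
  obtain ⟨C₂, hC₂⟩ := hbd (contDiff_dx hp).continuous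
  have t1 := tendsto_integral_weight_mul hp.continuous.aestronglyMeasurable hC₁ hφ hφ'
    h.memLp h.memLp_dx h.tendsto h.tendsto_dx
  have t2 := tendsto_integral_weight_mul (contDiff_dx hp).continuous.aestronglyMeasurable hC₂ hφ hφ
    h.memLp h.memLp h.tendsto h.tendsto
  have side : ∀ x, x = X ∨ x = -X → Tendsto
      (fun n => ∫ v, p (x, v) * (φ n (x, v) * φ n (x, v)) ∂sideMeas) atTop
      (𝓝 (∫ v, p (x, v) * (g (x, v) * g (x, v)) ∂sideMeas)) := by
    intro x hx
    have hpx : Continuous fun v => p (x, v) := hp.continuous.comp (by fun_prop)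
    obtain ⟨C, hC⟩ := isCompact_Icc.exists_bound_of_continuousOn (s := Icc (-1 : ℝ) 1)
      hpx.continuousOn
    have hlim : Tendsto (fun n => eLpNorm (fun v => φ n (x, v) - g (x, v)) 2 sideMeas) atTop
        (𝓝 0) :=
      tendsto_of_tendsto_of_tendsto_of_le_of_le tendsto_const_nhds h.tendsto_bdry
        (fun _ => zero_le) (fun n => eLpNorm_side_le hx (fun z => φ n z - g z))
    have hm : ∀ n, MemLp (fun v => φ n (x, v)) 2 sideMeas := fun n =>
      memLp_side_of_continuous ((h.smooth n).continuous.comp (by fun_prop))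
    refine tendsto_integral_weight_mul (C := C) hpx.aestronglyMeasurable ?_ hm hm
      (memLp_side hx h.memLp_bdry) (memLp_side hx h.memLp_bdry) hlim hlim
    filter_upwards [ae_restrict_mem measurableSet_Ioo] with v hv
    exact hC v (Ioo_subset_Icc_self hv)
  -- For each `φ n` the identity is `integral_dx` applied to `p φₙ²`; both sides converge.
  refine tendsto_nhds_unique ((t1.const_mul 2).add t2)
    (((side X (Or.inl rfl)).sub (side (-X) (Or.inr rfl))).congr fun n => ?_)
  have hs := h.smooth n
  have e := integral_dx hX (hp.mul (hs.mul hs))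
  have i1 : Integrable (fun z => p z * (φ n z * dx (φ n) z)) (domMeas X) :=
    ((hp.mul (hs.mul (contDiff_dx hs))).continuous.memLp_dom X 1).integrable le_rfl
  have i2 : Integrable (fun z => dx p z * (φ n z * φ n z)) (domMeas X) :=
    (((contDiff_dx hp).mul (hs.mul hs)).continuous.memLp_dom X 1).integrable le_rfl
  have i3 : ∀ x, Integrable (fun v => p (x, v) * (φ n (x, v) * φ n (x, v))) sideMeas := fun x =>
    (memLp_side_of_continuous ((hp.mul (hs.mul hs)).continuous.comp
      (by fun_prop : Continuous fun v => (x, v)))).integrable (by norm_num)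
  simp only [dx_mul_sq hp hs] at e
  rw [integral_add (i1.const_mul 2) i2, integral_const_mul, integral_sub (i3 X) (i3 (-X))] at e
  exact e.symm

/-- The weight `p = x` takes opposite signs at the two ends, so both boundary terms enter with the
same sign: `X` times a sum of two nonnegative integrals is zero. -/
theorem ApproxX.side_eq_zero {X : ℝ} (hX : 0 < X) {φ : ℕ → ℝ × ℝ → ℝ} {g : ℝ × ℝ → ℝ}
    (h : ApproxX X φ 0 0 g) {x : ℝ} (hx : x = X ∨ x = -X) :
    ∀ᵐ v ∂sideMeas, g (x, v) = 0 := by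
  have e := h.integral_weight hX (p := fun z => z.1) contDiff_fst
  simp only [Pi.zero_apply, mul_zero, integral_zero, integral_const_mul, add_zero] at e
  have n1 : ∀ y : ℝ, 0 ≤ ∫ v, g (y, v) * g (y, v) ∂sideMeas := fun y =>
    integral_nonneg fun v => mul_self_nonneg _
  have e' : (∫ v, g (X, v) * g (X, v) ∂sideMeas) + ∫ v, g (-X, v) * g (-X, v) ∂sideMeas = 0 := by
    refine (mul_eq_zero.1 (?_ : X * _ = 0)).resolve_left hX.ne'
    linarith
  have e0 : ∫ v, g (x, v) * g (x, v) ∂sideMeas = 0 := by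
    have := n1 X
    have := n1 (-X)
    rcases hx with rfl | rfl <;> linarith
  have hm := memLp_side hx h.memLp_bdry
  have := (integral_eq_zero_iff_of_nonneg (fun v => mul_self_nonneg (g (x, v)))
    (hm.integrable_mul hm)).1 e0
  filter_upwards [this] with v hv
  exact mul_self_eq_zero.1 hv

theorem IsTrace.approxX {X : ℝ} {u g : ℝ × ℝ → ℝ} (h : IsTrace X u g) :
    ∃ φ, ApproxX X φ u (wx X u) g := by
  obtain ⟨⟨hu, hd⟩, hg, φ, h1, h2, h3, -, h5⟩ := h
  exact ⟨φ, h1, hu, (isWeakD_weakD (hd (1, 0) (by simp))).1, hg, h2, h3, h5⟩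

/-- The trace is unique on the sides `x = ±X`. -/
theorem IsTrace.side_ae_eq {X : ℝ} (hX : 0 < X) {u g g' : ℝ × ℝ → ℝ} (h : IsTrace X u g)
    (h' : IsTrace X u g') {x : ℝ} (hx : x = X ∨ x = -X) :
    ∀ᵐ v ∂sideMeas, g (x, v) = g' (x, v) := by
  obtain ⟨φ, hφ⟩ := h.approxX
  obtain ⟨ψ, hψ⟩ := h'.approxX
  have hsub : ∀ {μ : Measure (ℝ × ℝ)} {a b : ℕ → ℝ × ℝ → ℝ} {f f' : ℝ × ℝ → ℝ},
      (∀ n, AEStronglyMeasurable (a n) μ) → (∀ n, AEStronglyMeasurable (b n) μ) →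
      AEStronglyMeasurable f μ → AEStronglyMeasurable f' μ →
      Tendsto (fun n => eLpNorm (fun z => a n z - f z) 2 μ) atTop (𝓝 0) →
      Tendsto (fun n => eLpNorm (fun z => b n z - f' z) 2 μ) atTop (𝓝 0) →
      Tendsto (fun n => eLpNorm (fun z => (a n z - b n z) - (f z - f' z)) 2 μ) atTop (𝓝 0) := by
    intro μ a b f f' ha hb hf hf' t t'
    have := t.add t'
    rw [add_zero] at this
    refine tendsto_of_tendsto_of_tendsto_of_le_of_le tendsto_const_nhds this
      (fun _ => zero_le) (fun n => ?_)
    have e : (fun z => (a n z - b n z) - (f z - f' z))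
        = (fun z => a n z - f z) - (fun z => b n z - f' z) := by
      funext z; simp only [Pi.sub_apply]; ring
    simp only [e]
    exact eLpNorm_sub_le ((ha n).sub hf) ((hb n).sub hf') (by norm_num)
  have hdx : ∀ n z, dx (fun z => φ n z - ψ n z) z = dx (φ n) z - dx (ψ n) z := by
    intro n z
    have := fderiv_fun_sub ((hφ.smooth n).differentiable (by simp) z)
      ((hψ.smooth n).differentiable (by simp) z)
    simp only [dx, this, sub_apply]
  -- Both sequences approach the same `u` and `wx X u`, so their difference approximates zero with
  -- boundary values `g - g'`.
  have key : ApproxX X (fun n z => φ n z - ψ n z) 0 0 (fun z => g z - g' z) := by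
    refine ⟨fun n => (hφ.smooth n).sub (hψ.smooth n), MemLp.zero, MemLp.zero,
      hφ.memLp_bdry.sub hψ.memLp_bdry, ?_, ?_, ?_⟩
    · have := hsub (fun n => (hφ.smooth n).continuous.aestronglyMeasurable)
        (fun n => (hψ.smooth n).continuous.aestronglyMeasurable) hφ.memLp.1 hψ.memLp.1
        hφ.tendsto hψ.tendsto
      simpa only [sub_self, Pi.zero_apply] using this
    · have := hsub (fun n => (contDiff_dx (hφ.smooth n)).continuous.aestronglyMeasurable)
        (fun n => (contDiff_dx (hψ.smooth n)).continuous.aestronglyMeasurable)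
        hφ.memLp_dx.1 hψ.memLp_dx.1 hφ.tendsto_dx hψ.tendsto_dx
      simpa only [sub_self, hdx, Pi.zero_apply] using this
    · exact hsub (fun n => (hφ.smooth n).continuous.aestronglyMeasurable)
        (fun n => (hψ.smooth n).continuous.aestronglyMeasurable) hφ.memLp_bdry.1 hψ.memLp_bdry.1
        hφ.tendsto_bdry hψ.tendsto_bdry
  filter_upwards [key.side_eq_zero hX hx] with v hv
  exact sub_eq_zero.1 hv

theorem isTrace_trace {X : ℝ} {u : ℝ × ℝ → ℝ} (h : ∃ g, IsTrace X u g) :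
    IsTrace X u (trace X u) := by
  rw [trace, dif_pos h]; exact h.choose_spec

/-! ### The outflow energy -/

/-- The horizontal sides are open segments and miss `x = ±X`; `X > 0` keeps the two vertical sides
apart. -/
theorem bdryMeas_restrict_outflow {X : ℝ} (hX : 0 < X) : (bdryMeas X).restrict (outflow X)
    = (volume.restrict (Ioo (-1 : ℝ) 0)).map (fun v => (-X, v))
      + (volume.restrict (Ioo (0 : ℝ) 1)).map (fun v => (X, v)) := by
  have hm : MeasurableSet (outflow X) :=
    ((measurableSet_singleton _).prod measurableSet_Ioo).union
      ((measurableSet_singleton _).prod measurableSet_Ioo)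
  have hX' : -X ≠ X := by linarith
  have key : ∀ {γ : ℝ → ℝ × ℝ} (_ : Measurable γ) {s t : Set ℝ} (_ : γ ⁻¹' outflow X ∩ s = t),
      ((volume.restrict s).map γ).restrict (outflow X) = (volume.restrict t).map γ := by
    intro γ hγ s t h
    rw [Measure.restrict_map hγ hm, Measure.restrict_restrict (hγ hm), h]
  have hl : (fun v : ℝ => (-X, v)) ⁻¹' outflow X ∩ Ioo (-1) 1 = Ioo (-1) 0 := by
    ext v
    simp only [outflow, mem_inter_iff, mem_preimage, mem_union, mem_prod, mem_singleton_iff,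
      mem_Ioo, true_and, hX', false_and, or_false]
    constructor
    · exact fun h => h.1
    · exact fun h => ⟨h, h.1, by linarith [h.2]⟩
  have hr : (fun v : ℝ => (X, v)) ⁻¹' outflow X ∩ Ioo (-1) 1 = Ioo 0 1 := by
    ext v
    simp only [outflow, mem_inter_iff, mem_preimage, mem_union, mem_prod, mem_singleton_iff,
      mem_Ioo, true_and, hX'.symm, false_and, false_or]
    constructor
    · exact fun h => h.1
    · exact fun h => ⟨h, by linarith [h.1], h.2⟩
  have hh : ∀ y : ℝ, (fun x : ℝ => (x, y)) ⁻¹' outflow X ∩ Ioo (-X) X = ∅ := by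
    intro y
    ext x
    simp only [outflow, mem_inter_iff, mem_preimage, mem_union, mem_prod, mem_singleton_iff,
      mem_Ioo, mem_empty_iff_false, iff_false, not_and, not_lt]
    rintro (h | h) h'
    · linarith [h.1]
    · exact h.1.ge
  rw [bdryMeas, Measure.restrict_add, Measure.restrict_add, Measure.restrict_add,
    key (by fun_prop) hl, key (by fun_prop) hr, key (by fun_prop) (hh (-1)),
    key (by fun_prop) (hh 1)]
  simp

theorem ae_side_of_ae_bdry {X x : ℝ} (hx : x = X ∨ x = -X) {P : ℝ × ℝ → Prop}
    (h : ∀ᵐ z ∂bdryMeas X, P z) : ∀ᵐ v ∂sideMeas, P (x, v) :=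
  (measurableEmbedding_prodMk_left x).ae_map_iff.1 (ae_mono (map_side_le_bdryMeas hx) h)

theorem setIntegral_outflow {X : ℝ} (hX : 0 < X) {f : ℝ × ℝ → ℝ}
    (hl : Integrable (fun v => f (-X, v)) sideMeas) (hr : Integrable (fun v => f (X, v)) sideMeas) :
    ∫ z in outflow X, f z ∂bdryMeas X
      = (∫ v in Ioo (-1 : ℝ) 0, f (-X, v)) + ∫ v in Ioo (0 : ℝ) 1, f (X, v) := by
  have el := measurableEmbedding_prodMk_left (β := ℝ) (-X)
  have er := measurableEmbedding_prodMk_left (β := ℝ) X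
  rw [bdryMeas_restrict_outflow hX, integral_add_measure, el.integral_map, er.integral_map]
  · exact el.integrable_map_iff.2
      (IntegrableOn.mono_set hl (Ioo_subset_Ioo_right (by norm_num)))
  · exact er.integrable_map_iff.2
      (IntegrableOn.mono_set hr (Ioo_subset_Ioo_left (by norm_num)))

theorem integrable_side_weight {X x : ℝ} (hx : x = X ∨ x = -X) {g : ℝ × ℝ → ℝ}
    (hg : MemLp g 2 (bdryMeas X)) : Integrable (fun v => g (x, v) ^ 2 * |v|) sideMeas := by
  have hm := memLp_side hx hg
  have hi : Integrable (fun v => g (x, v) ^ 2) sideMeas := hm.integrable_sq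
  refine hi.mono' (hi.1.mul continuous_abs.aestronglyMeasurable) ?_
  filter_upwards [ae_restrict_mem measurableSet_Ioo] with v hv
  rw [Real.norm_eq_abs, abs_of_nonneg (by positivity)]
  exact mul_le_of_le_one_right (by positivity) (abs_le.2 ⟨hv.1.le, hv.2.le⟩)

/-- Transport by `v ∂ₓ` of a function with zero trace on the inflow boundary produces the outflow
energy. -/
theorem integral_transport {X : ℝ} (hX : 0 < X) {u u' : ℝ × ℝ → ℝ} (hu' : IsWeakD X (1, 0) u u')
    {S : Set (ℝ × ℝ)} (h0 : TraceZeroOn X (inflow X ∪ S) u) :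
    ∫ z, z.2 * (u z * u' z) ∂domMeas X
      = 1 / 2 * ∫ z in outflow X, trace X u z ^ 2 * |z.2| ∂bdryMeas X := by
  obtain ⟨g, hg, hz⟩ := h0
  have htr := isTrace_trace ⟨g, hg⟩
  have hgL := htr.2.1
  obtain ⟨φ, hφ⟩ := htr.approxX
  -- The vanishing is known for some trace `g`; uniqueness carries it to the chosen one.
  have hae : ∀ x, x = X ∨ x = -X → ∀ᵐ v ∂sideMeas, (x, v) ∈ inflow X → trace X u (x, v) = 0 := by
    intro x hx
    filter_upwards [ae_side_of_ae_bdry hx (ae_imp_of_ae_restrict hz), hg.side_ae_eq hX htr hx]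
      with v h1 h2 hv
    rw [← h2]; exact h1 (Or.inl hv)
  have e := hφ.integral_weight hX (p := fun z => z.2) contDiff_snd
  have hd : ∀ z : ℝ × ℝ, dx (fun z => z.2) z = 0 := fun z => by
    simp only [dx]
    rw [show fderiv ℝ (fun z : ℝ × ℝ => z.2) z = _ from (hasFDerivAt_snd (𝕜 := ℝ)).fderiv]
    simp
  have e1 : ∫ z, z.2 * (u z * u' z) ∂domMeas X = ∫ z, z.2 * (u z * wx X u z) ∂domMeas X := by
    refine integral_congr_ae ?_
    filter_upwards [hu'.weakD_ae_eq] with z h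
    simp only [wx, h]
  -- At `x = X` the inflow is `v ≤ 0`, and `v = |v|` on what remains. At `x = -X` the remainder is
  -- `v < 0`, and `v = -|v|` offsets the minus sign of the lower endpoint.
  have er : ∫ v in Ioo (-1 : ℝ) 1, v * (trace X u (X, v) * trace X u (X, v))
      = ∫ v in Ioo (0 : ℝ) 1, trace X u (X, v) ^ 2 * |v| := by
    rw [setIntegral_eq_of_subset_of_ae_sdiff_eq_zero (s := Ioo (0 : ℝ) 1)
      measurableSet_Ioo.nullMeasurableSet (Ioo_subset_Ioo_left (by norm_num))]
    · refine setIntegral_congr_fun measurableSet_Ioo fun v hv => ?_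
      simp only [abs_of_pos hv.1]; ring
    · filter_upwards [(ae_restrict_iff' measurableSet_Ioo).1 (hae X (Or.inl rfl))] with v h hv
      have h0 : v ≤ 0 := not_lt.1 fun h' => hv.2 ⟨h', hv.1.2⟩
      rw [h hv.1 (Or.inr ⟨rfl, hv.1.1, h0⟩)]; ring
  have el : ∫ v in Ioo (-1 : ℝ) 1, v * (trace X u (-X, v) * trace X u (-X, v))
      = -∫ v in Ioo (-1 : ℝ) 0, trace X u (-X, v) ^ 2 * |v| := by
    rw [setIntegral_eq_of_subset_of_ae_sdiff_eq_zero (s := Ioo (-1 : ℝ) 0)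
      measurableSet_Ioo.nullMeasurableSet (Ioo_subset_Ioo_right (by norm_num)), ← integral_neg]
    · refine setIntegral_congr_fun measurableSet_Ioo fun v hv => ?_
      simp only [abs_of_neg hv.2]; ring
    · filter_upwards [(ae_restrict_iff' measurableSet_Ioo).1 (hae (-X) (Or.inr rfl))] with v h hv
      have h0 : 0 ≤ v := not_lt.1 fun h' => hv.2 ⟨hv.1.1, h'⟩
      rw [h hv.1 (Or.inl ⟨rfl, h0, hv.1.2⟩)]; ring
  rw [setIntegral_outflow hX (integrable_side_weight (Or.inr rfl) hgL)
    (integrable_side_weight (Or.inl rfl) hgL), e1]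
  simp only [hd, zero_mul, integral_zero, add_zero] at e
  rw [er, el] at e
  linarith

theorem outflowNormSq_eq_sum {X : ℝ} (hX : 0 < X) {M : Matrix (Fin 2) (Fin 2) ℝ} {w : ℝ × ℝ → ℝ}
    (h : ∀ i : Fin 3, ∃ g, IsTrace X (fun z => opH X M w z i) g) :
    outflowNormSq X M w = ∑ i : Fin 3,
      ∫ z in outflow X, trace X (fun y => opH X M w y i) z ^ 2 * |z.2| ∂bdryMeas X := by
  have hL := fun i => (isTrace_trace (h i)).2.1
  have hi : ∀ i x, x = X ∨ x = -X → Integrable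
      (fun v => trace X (fun y => opH X M w y i) (x, v) ^ 2 * |v|) sideMeas :=
    fun i x hx => integrable_side_weight hx (hL i)
  rw [outflowNormSq, ← integral_finsetSum]
  · simp only [Finset.sum_mul]
  · intro i _
    rw [bdryMeas_restrict_outflow hX]
    refine Integrable.add_measure ?_ ?_
    · exact (measurableEmbedding_prodMk_left (-X)).integrable_map_iff.2
        (IntegrableOn.mono_set (hi i _ (Or.inr rfl)) (Ioo_subset_Ioo_right (by norm_num)))
    · exact (measurableEmbedding_prodMk_left X).integrable_map_iff.2
        (IntegrableOn.mono_set (hi i _ (Or.inl rfl)) (Ioo_subset_Ioo_left (by norm_num)))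

/-! ### Energy identity and coercivity -/

theorem integrable_dotProduct_mulVec {X : ℝ} {f g : ℝ × ℝ → Fin 2 → ℝ}
    (hf : ∀ i, MemLp (fun z => f z i) 2 (domMeas X))
    (hg : ∀ i, MemLp (fun z => g z i) 2 (domMeas X)) (A : Matrix (Fin 2) (Fin 2) ℝ) :
    Integrable (fun z => f z ⬝ᵥ A *ᵥ g z) (domMeas X) := by
  simp only [Matrix.mulVec, dotProduct, Fin.sum_univ_two]
  exact (integrable_mul (hf 0) (MemLp.const_mul_add (hg 0) (hg 1) _ _)).add
    (integrable_mul (hf 1) (MemLp.const_mul_add (hg 0) (hg 1) _ _))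

theorem lamMin_mul_innerL2_le {X : ℝ} {f : ℝ × ℝ → Fin 2 → ℝ}
    (hf : ∀ i, MemLp (fun z => f z i) 2 (domMeas X)) {A : Matrix (Fin 2) (Fin 2) ℝ}
    (hA : A 1 0 = A 0 1) :
    lamMin A * innerL2 X f f ≤ innerL2 X f (fun z => A *ᵥ f z) := by
  rw [innerL2, innerL2, ← integral_const_mul]
  refine integral_mono ?_ (integrable_dotProduct_mulVec hf hf A) fun z => lamMin_mul_le hA _
  have := (integrable_dotProduct_mulVec hf hf 1).const_mul (lamMin A)
  simpa only [Matrix.one_mulVec] using this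

theorem opH_dotProduct_opH {X : ℝ} {M : Matrix (Fin 2) (Fin 2) ℝ} (hM : M.PosSemidef)
    (w φ : ℝ × ℝ → ℝ) (z : ℝ × ℝ) :
    opH X M w z ⬝ᵥ opH X M φ z = w z * φ z + grad X w z ⬝ᵥ M *ᵥ grad X φ z := by
  rw [opH, opH, Matrix.cons_dotProduct_cons, sqrt_mulVec_dotProduct hM]

/-- The energy identity for the hypocoercive form. -/
theorem form_self_eq {X ε : ℝ} (hX : 0 < X) {M : Matrix (Fin 2) (Fin 2) ℝ} (hM : M.PosSemidef)
    (hMs : M 1 0 = M 0 1) {w : ℝ × ℝ → ℝ} (hw : w ∈ H2Zero X M)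
    (hgradv : ∀ i, MemLp (fun z => grad X (wv X w) z i) 2 (domMeas X)) :
    form X ε M w w = 1 / 2 * outflowNormSq X M w
      + innerL2 X (grad X w) (fun z => matN ε M *ᵥ grad X w z)
      + ε * innerL2 X (grad X (wv X w)) (fun z => M *ᵥ grad X (wv X w) z) := by
  obtain ⟨⟨hwL, hD⟩, htr⟩ := hw
  have hp : IsWeakD X (1, 0) w (wx X w) := isWeakD_weakD (hD _ (by simp))
  have hq : IsWeakD X (0, 1) w (wv X w) := isWeakD_weakD (hD _ (by simp))
  have hA := isWeakD_weakD (hD (2, 0) (by simp))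
  have hB := isWeakD_weakD (hD (1, 1) (by simp))
  generalize weakD X (2, 0) w = A at hA
  generalize weakD X (1, 1) w = B at hB
  have hpx := hp.x_x hA
  have hqx := hq.x_v hB
  -- With `A = w_xx` and `B = w_xv`, this is the weak derivative `∂ₓℋw`.
  let D : Fin 3 → ℝ × ℝ → ℝ := fun i z =>
    (Matrix.vecCons (wx X w z) (CFC.sqrt M *ᵥ ![A z, B z]) : Fin 3 → ℝ) i
  have hcomp : ∀ i : Fin 2, ∀ a b : ℝ × ℝ → ℝ, (fun z => (CFC.sqrt M *ᵥ ![a z, b z]) i)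
      = fun z => CFC.sqrt M i 0 * a z + CFC.sqrt M i 1 * b z := by
    intro i a b
    funext z
    simp [Matrix.mulVec, dotProduct, Fin.sum_univ_two]
  have hDU : ∀ i, IsWeakD X (1, 0) (fun z => opH X M w z i) (D i) := by
    have hsucc : ∀ i : Fin 2, IsWeakD X (1, 0) (fun z => (CFC.sqrt M *ᵥ ![wx X w z, wv X w z]) i)
        (fun z => (CFC.sqrt M *ᵥ ![A z, B z]) i) := by
      intro i
      rw [hcomp, hcomp]
      exact IsWeakD.lincomb hp.1 hq.1 hpx hqx _ _
    refine Fin.cases ?_ hsucc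
    exact hp
  have hUL : ∀ i, MemLp (fun z => opH X M w z i) 2 (domMeas X) := by
    refine Fin.cases hwL fun i => ?_
    change MemLp (fun z => (CFC.sqrt M *ᵥ ![wx X w z, wv X w z]) i) 2 (domMeas X)
    rw [hcomp]
    exact MemLp.const_mul_add hp.1 hq.1 _ _
  have hout : ∑ i, ∫ z, z.2 * (opH X M w z i * D i z) ∂domMeas X
      = 1 / 2 * outflowNormSq X M w := by
    rw [outflowNormSq_eq_sum hX fun i => (htr i).imp fun _ h => h.1, Finset.mul_sum]
    exact Finset.sum_congr rfl fun i _ => integral_transport hX (hDU i) (htr i)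
  have hUDi : ∀ i, Integrable (fun z => z.2 * (opH X M w z i * D i z)) (domMeas X) := by
    intro i
    simp only [← mul_assoc]
    exact integrable_mul (MemLp.snd_mul (hUL i)) (hDU i).1
  have hgx : weakD X (1, 0) (fun z => z.2 * wx X w z) =ᵐ[domMeas X] fun z => z.2 * A z :=
    hpx.snd_mul_x.weakD_ae_eq
  have hgv : weakD X (0, 1) (fun z => z.2 * wx X w z) =ᵐ[domMeas X]
      fun z => z.2 * B z + wx X w z :=
    (IsWeakD.snd_mul_v hp.1 (hp.v_x hB)).weakD_ae_eq
  have hcross : Integrable (fun z => wx X w z * (M 1 0 * wx X w z + M 1 1 * wv X w z))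
      (domMeas X) :=
    integrable_mul hp.1 (MemLp.const_mul_add hp.1 hq.1 _ _)
  -- `ℋ(v w_x)` exceeds `v ∂ₓℋw` by `(0, √M (0, w_x))`; pairing that with `ℋw` gives `w_x` times the
  -- second entry of `M∇w`.
  have h1 : innerH X M (fun z => z.2 * wx X w z) w = 1 / 2 * outflowNormSq X M w
      + ∫ z, wx X w z * (M 1 0 * wx X w z + M 1 1 * wv X w z) ∂domMeas X := by
    rw [← hout, ← integral_finsetSum _ fun i _ => hUDi i,
      ← integral_add (integrable_finsetSum _ fun i _ => hUDi i) hcross, innerH, innerL2]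
    refine integral_congr_ae ?_
    filter_upwards [hgx, hgv] with z e1 e2
    have e3 : ∑ i, z.2 * (opH X M w z i * D i z) = z.2 * (w z * wx X w z
        + ![A z, B z] ⬝ᵥ M *ᵥ grad X w z) := by
      rw [← Finset.mul_sum, ← sqrt_mulVec_dotProduct hM, dotProduct_comm (CFC.sqrt M *ᵥ ![A z, B z]),
        ← Matrix.cons_dotProduct_cons]
      rfl
    rw [e3, opH_dotProduct_opH hM]
    simp only [grad, wx, wv] at e1 e2 ⊢
    rw [e1, e2]
    simp only [Matrix.mulVec, dotProduct, Fin.sum_univ_two, Matrix.cons_val_zero,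
      Matrix.cons_val_one]
    ring
  have hqq := integrable_mul hq.1 hq.1
  have h2 : innerH X M (wv X w) (wv X w) = ∫ z, wv X w z * wv X w z ∂domMeas X
      + innerL2 X (grad X (wv X w)) (fun z => M *ᵥ grad X (wv X w) z) := by
    rw [innerH, innerL2, innerL2,
      ← integral_add hqq (integrable_dotProduct_mulVec hgradv hgradv M)]
    simp only [opH_dotProduct_opH hM]
  -- The cross term `M₂₂ w_x w_v` is split evenly between the off-diagonal entries, whence the
  -- halves in `N`.
  have h3 : innerL2 X (grad X w) (fun z => matN ε M *ᵥ grad X w z)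
      = ∫ z, wx X w z * (M 1 0 * wx X w z + M 1 1 * wv X w z) ∂domMeas X
        + ε * ∫ z, wv X w z * wv X w z ∂domMeas X := by
    rw [innerL2, ← integral_const_mul, ← integral_add hcross (hqq.const_mul ε)]
    congr 1
    funext z
    simp only [grad, matN, Matrix.mulVec, dotProduct, Fin.sum_univ_two, Matrix.cons_val_zero,
      Matrix.cons_val_one, Matrix.of_apply, hMs]
    ring
  rw [form, h1, h2, h3]
  ring

end Kolmogorov

theorem mainTheorem3 (X ε : ℝ) (hX : 0 < X) (hε : 0 < ε)
    (M : Matrix (Fin 2) (Fin 2) ℝ) (hM : M.PosSemidef) (hM0 : ∀ i j, 0 ≤ M i j)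
    (hN : 4 * ε * M 0 1 > M 1 1 ^ 2)
    (w : ℝ × ℝ → ℝ) (hw : w ∈ Kolmogorov.H2Zero X M) :
    0 < Kolmogorov.lamMin (Kolmogorov.matN ε M) ∧
    Kolmogorov.form X ε M w w
      = 1 / 2 * Kolmogorov.outflowNormSq X M w
        + Kolmogorov.innerL2 X (Kolmogorov.grad X w)
            (fun z => Kolmogorov.matN ε M *ᵥ Kolmogorov.grad X w z)
        + ε * Kolmogorov.innerL2 X (Kolmogorov.grad X (Kolmogorov.wv X w))
            (fun z => M *ᵥ Kolmogorov.grad X (Kolmogorov.wv X w) z) ∧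
    Kolmogorov.form X ε M w w
      ≥ 1 / 2 * Kolmogorov.outflowNormSq X M w
        + Kolmogorov.lamMin (Kolmogorov.matN ε M)
          * Kolmogorov.innerL2 X (Kolmogorov.grad X w) (Kolmogorov.grad X w)
        + ε * Kolmogorov.lamMin M
          * Kolmogorov.innerL2 X (Kolmogorov.grad X (Kolmogorov.wv X w))
              (Kolmogorov.grad X (Kolmogorov.wv X w)) := by
  open Kolmogorov in
  have hMs : M 1 0 = M 0 1 := by simpa using hM.isHermitian.apply 0 1
  have hD := hw.1.2
  have hp : IsWeakD X (1, 0) w (wx X w) := isWeakD_weakD (hD _ (by simp))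
  have hq : IsWeakD X (0, 1) w (wv X w) := isWeakD_weakD (hD _ (by simp))
  have hgrad : ∀ i, MemLp (fun z => grad X w z i) 2 (domMeas X) :=
    Fin.forall_fin_two.2 ⟨hp.1, hq.1⟩
  have hgradv : ∀ i, MemLp (fun z => grad X (wv X w) z i) 2 (domMeas X) :=
    Fin.forall_fin_two.2
      ⟨(isWeakD_weakD ⟨_, hq.x_v (isWeakD_weakD (hD (1, 1) (by simp)))⟩).1,
        (isWeakD_weakD ⟨_, hq.v_v (isWeakD_weakD (hD (0, 2) (by simp)))⟩).1⟩
  have heq := form_self_eq (ε := ε) hX hM hMs hw hgradv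
  have hle := lamMin_mul_innerL2_le hgrad (A := matN ε M) (by simp [matN])
  have hle' := mul_le_mul_of_nonneg_left (lamMin_mul_innerL2_le hgradv hMs) hε.le
  -- The determinant condition `(M₂₂/2)² < M₁₂ ε` is `hN` divided by 4.
  refine ⟨lamMin_pos hε (by linarith), heq, ?_⟩
  rw [heq]
  linarith
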